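/- Let $\Gamma$ be a totally ordered alphabet and let $\{a,b\}$ be ordered by $a<b$. For a finite word $w$, the Burrows–Wheeler transform $\mathrm{bwt}(w)$ is the word formed by the last letters of the $|w|$ rotations of $w$ (counted with multiplicity), listed in ascending lexicographic order, and $r(w)$ is the number of maximal blocks of equal letters in $\mathrm{bwt}(w)$. For a morphism $\mu:\{a,b\}^*\to\Gamma^*$ let $$AS_\mu(n)=\max_{w\in\{a,b\}^n}\bigl(r(\mu(w))-r(w)\bigr)$$ be its additive sensitivity function. Write $\mu=(x,y)$ if $\mu(a)=x$ and $\mu(b)=y$, and put $E=(b,a)$ and $\rho_p=(a,b^p)$ for $p\ge 1$, both as morphisms $\{a,b\}^*\to\{a,b\}^*$. A word $w$ is primitive if $w=u^k$ with $u$ non-empty implies $k=1$. Here $f(n)=\Omega(\sqrt n)$ means that there is $c>0$ (which may depend on the morphism) with $f(n)\ge c\sqrt n$ for all sufficiently large $n$. 1. For every integer $p>1$, $AS_{\rho_p}(n)=\Omega(\sqrt n)$. 2. Let $\mu:\{a,b\}^*\to\Gamma^*$ be an injective morphism. Then there are primitive words $u,v\in\Gamma^*$ and integers $p,q\ge 1$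 such that $\mu=(u^p,v^q)$. For all such $u,v,p,q$, $$\mu=\eta\circ\rho_q\circ E\circ\rho_p\circ E,\qquad\text{where }\eta=(u,v),$$ and if $pq>1$, then $AS_\mu(n)=\Omega(\sqrt n)$. -/

import Mathlib

namespace BWTRuns

/-- A word over `α` is primitive if it is not a proper power: `w = u ^ k` with `u` nonempty
forces `k = 1`. -/
def IsPrimitive {α : Type*} (w : FreeMonoid α) : Prop :=
  ∀ u : FreeMonoid α, u ≠ 1 → ∀ k : ℕ, w = u ^ k → k = 1

/-- The run-length encoding of a word: the sequence of pairs `(c, l)` of the letters and the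
lengths of its maximal blocks of equal letters. -/
def rle {α : Type*} [DecidableEq α] : List α → List (α × ℕ)
  | [] => []
  | c :: w =>
    match rle w with
    | [] => [(c, 1)]
    | (d, l) :: t => if c = d then (d, l + 1) :: t else (c, 1) :: (d, l) :: t

/-- The list of all rotations of `w` (with multiplicity, so `|w|` of them), sorted in ascending
lexicographic order. -/
def sortedRotations {α : Type*} [LinearOrder α] (w : List α) : List (List α) :=
  ((List.range w.length).map fun i => w.rotate i).insertionSort (· ≤ ·)

/-- The Burrows-Wheeler transform: the concatenation of the last letters of the sorted
rotations. -/
def bwt {α : Type*} [LinearOrder α] (w : List α) : List α :=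
  (sortedRotations w).filterMap List.getLast?

/-- The number `r(w)` of equal-letter runs of the Burrows-Wheeler transform of `w`. -/
def r {α : Type*} [LinearOrder α] (w : FreeMonoid α) : ℕ :=
  (rle (bwt w.toList)).length

/-- The additive increase `r(μ(w)) - r(w)`, an integer that may be negative. -/
def deltaAdd {α β : Type*} [LinearOrder α] [LinearOrder β]
    (μ : FreeMonoid α →* FreeMonoid β) (w : FreeMonoid α) : ℤ :=
  (r (μ w) : ℤ) - (r w : ℤ)

/-- The additive sensitivity function `AS_μ(n)`: the maximum of `deltaAdd μ w` over all the
words `w` of length `n`. -/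
def AS {α β : Type*} [LinearOrder α] [Fintype α] [Nonempty α] [LinearOrder β]
    (μ : FreeMonoid α →* FreeMonoid β) (n : ℕ) : ℤ :=
  (Finset.univ : Finset (Fin n → α)).sup' Finset.univ_nonempty
    fun w => deltaAdd μ (FreeMonoid.ofList (List.ofFn w))

/-- The binary alphabet `{a, b}` with `a < b`, where `a = 0` and `b = 1`. -/
abbrev Binary : Type := Fin 2

/-- The letter `a`, as a word. -/
def a : FreeMonoid Binary := FreeMonoid.of 0

/-- The letter `b`, as a word. -/
def b : FreeMonoid Binary := FreeMonoid.of 1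

/-- The binary morphism `(u, v)`, which maps `a` to `u` and `b` to `v`. -/
def morphism {Γ : Type*} (u v : FreeMonoid Γ) : FreeMonoid Binary →* FreeMonoid Γ :=
  FreeMonoid.lift ![u, v]

/-- The morphism `E = (b, a)`. -/
def E : FreeMonoid Binary →* FreeMonoid Binary := morphism b a

/-- The morphism `ρ_p = (a, b ^ p)`. -/
def rho (p : ℕ) : FreeMonoid Binary →* FreeMonoid Binary := morphism a (b ^ p)

end BWTRuns

/-!
The proof compares numbers of runs through lists of rotations. If an ascending list of rotations of
`w` is given, the sequence of their last letters has at most `r w` runs, with or without repetitions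
(`runs_map_le_of_subset`, `runs_map_getLast?_le_r`). So a lower bound for `r w'` only needs a
well-chosen ascending list of rotations of `w'`.

*Morphisms do not destroy runs* (`r_le_r_flatMap`). Let `f` be a binary morphism whose two images do
not commute. If `t` is the longest common prefix of `f(ab)` and `f(ba)`, then `f(x) t` starts with
`t c_i`, where `i` is the first letter of `x` and `c_a ≠ c_b`. Hence `f` is strictly monotone, or
strictly antitone, on every conjugacy class. The same fact for reversed words allows `f` to be
conjugated so that its images end in distinct letters; the number of runs does not change, because
it depends on the conjugacy class of a word only. Then the images of the sorted rotations of `z` are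
sorted up to reversal, and their last letters spell a recoding of `bwt z`.

*`rho p` creates runs* (`r_spell_add_two_mul_card_le`). Let `w` be the product of the words
`b ^ (j + 1) a ^ (e j)`. If `e j` is smaller and `e (j + 1)` larger than all later exponents, then
the rotations of `w` at the blocks `j` and `j + 1` are neighbours in the sorted list, and both end
in `a` (`blockRotation_succ_le`). In the image under `rho p` a rotation that ends in `b` falls
between them, which makes two new runs. Exponents that zigzag satisfy the condition for all odd `j`, so a
word of length `n` gains a number of runs of order `√n`.

*The general case.* The morphism `(u ^ p, v ^ q)` is `(u ^ p, v) ∘ rho q`, and composed with the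
exchange `E` of the letters it is `(v ^ q, u) ∘ rho p`. The outer factors do not destroy runs, and
neither does `E`, in either direction. So the lower bound for `rho q` or `rho p` carries over.
-/

namespace BWTRuns

/-! ### Runs of a word -/

/-- The number of maximal blocks of equal letters of a word, as the length of the word that
remains when each block is contracted to one letter. -/
def runs {α : Type*} [DecidableEq α] (l : List α) : ℕ := (l.destutter (· ≠ ·)).length

section Runs

variable {α β : Type*} [DecidableEq α] [DecidableEq β]

@[simp] lemma runs_nil : runs ([] : List α) = 0 := rfl

@[simp] lemma runs_singleton (x : α) : runs [x] = 1 := rfl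

lemma runs_cons_cons_self (x : α) (l : List α) : runs (x :: x :: l) = runs (x :: l) := by
  simp [runs, List.destutter_cons']

lemma runs_cons_cons_of_ne {x y : α} (h : x ≠ y) (l : List α) :
    runs (x :: y :: l) = runs (y :: l) + 1 := by
  simp [runs, List.destutter_cons', h]

lemma length_rle (l : List α) : (rle l).length = runs l := by
  suffices h : (rle l).length = runs l ∧ (rle l).head?.map Prod.fst = l.head? from h.1
  induction l with
  | nil => simp [rle]
  | cons x l ih =>
    cases l with
    | nil => simp [rle]
    | cons y l =>
      obtain ⟨h₁, h₂⟩ := ih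
      rw [rle]
      cases h : rle (y :: l) with
      | nil => simp [h] at h₂
      | cons d t =>
        obtain ⟨d, k⟩ := d
        have hd : d = y := by simpa [h] using h₂
        subst hd
        rw [h] at h₁
        by_cases hx : x = d
        · subst hx
          simp [runs_cons_cons_self, ← h₁]
        · simp [hx, runs_cons_cons_of_ne hx, ← h₁]

lemma runs_map_of_injective {f : α → β} (hf : Function.Injective f) (l : List α) :
    runs (l.map f) = runs l := by
  have h := congrArg List.length (List.map_destutter_ne (l := l) hf)
  rw [List.length_map] at h
  exact h.symm

lemma runs_le_runs_reverse (l : List α) : runs l ≤ runs l.reverse := by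
  have h : ((l.destutter (· ≠ ·)).reverse).IsChain (· ≠ ·) := by
    rw [List.isChain_reverse]
    exact (List.isChain_destutter _ l).imp fun _ _ h => h.symm
  simpa [runs] using h.length_le_length_destutter_ne (List.destutter_sublist _ l).reverse

/-- Passing from an ascending list to one with more entries cannot destroy runs of labels.
Repetitions are harmless because equal entries have equal labels and are adjacent. -/
lemma runs_map_le_of_subset {α : Type*} [LinearOrder α] (f : α → β) {l m : List α}
    (hl : l.Pairwise (· ≤ ·)) (hm : m.Pairwise (· ≤ ·)) (h : l ⊆ m) :
    runs (l.map f) ≤ runs (m.map f) := by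
  obtain ⟨k, hk, hkf⟩ := List.sublist_map_iff.1 (List.destutter_sublist (· ≠ ·) (l.map f))
  have hc := List.isChain_destutter (· ≠ ·) (l.map f)
  rw [runs, hkf]
  rw [hkf] at hc
  have hkle : k.Pairwise (· ≤ ·) := hl.sublist hk
  have hlt : k.IsChain (· < ·) := by
    rw [List.isChain_map] at hc
    have hk' := hkle.isChain
    rw [List.isChain_iff_getElem] at hc hk' ⊢
    exact fun i hi => lt_of_le_of_ne (hk' i hi) fun e => hc i hi (congrArg f e)
  have hnd : k.Nodup := hlt.pairwise.imp fun h => h.ne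
  have hsub : k.Sublist m := List.sublist_of_subperm_of_pairwise
    (List.subperm_of_subset hnd fun x hx => h (hk.subset hx)) hkle hm
  exact hc.length_le_length_destutter_ne (hsub.map f)

/-- Inserting a letter `B` after every marked entry `x` of an ascending list adds two runs for each
mark, provided that `x` and its successor in the list both have the label `A ≠ B`. -/
lemma runs_flatMap_insert {α : Type*} [LinearOrder α] (lab : α → β) {A B : β}
    (hAB : A ≠ B) (P : α → Prop) [DecidablePred P] {l : List α} (hl : l.Pairwise (· < ·))
    (h : ∀ x ∈ l, P x → lab x = A ∧ ∃ y ∈ l, x < y ∧ lab y = A ∧ ∀ z ∈ l, x < z → y ≤ z) :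
    runs (l.flatMap fun x => if P x then [lab x, B] else [lab x])
      = runs (l.map lab) + 2 * l.countP P := by
  induction l with
  | nil => simp
  | cons x l ih =>
    rw [List.pairwise_cons] at hl
    have ih' := ih hl.2 (by
      intro z hz hPz
      obtain ⟨h₁, y, hy, hzy, h₂, h₃⟩ := h z (List.mem_cons_of_mem _ hz) hPz
      refine ⟨h₁, y, ?_, hzy, h₂, fun t ht => h₃ t (List.mem_cons_of_mem _ ht)⟩
      rcases List.mem_cons.1 hy with rfl | hy
      · exact absurd hzy (hl.1 z hz).not_gt
      · exact hy)
    have hx := h x (by simp)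
    clear h ih
    cases l with
    | nil =>
      by_cases hP : P x
      · obtain ⟨-, y, hy, hxy, -⟩ := hx hP
        simp only [List.mem_singleton] at hy
        exact absurd hxy (by simp [hy])
      · simp [hP]
    | cons y l =>
      obtain ⟨k, hk⟩ : ∃ k, ((y :: l).flatMap fun x => if P x then [lab x, B] else [lab x])
          = lab y :: k := by
        by_cases hP : P y <;> simp [hP]
      rw [hk] at ih'
      rw [List.flatMap_cons, hk]
      simp only [List.map_cons] at ih' ⊢
      by_cases hP : P x
      · obtain ⟨hxA, z, hz, hxz, hzA, hmin⟩ := hx hP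
        have hyz : y = z := by
          have h₁ : z ≤ y := hmin y (by simp) (hl.1 y (by simp))
          rcases List.mem_cons.1 hz with rfl | hz
          · exact absurd hxz (lt_irrefl _)
          rcases List.mem_cons.1 hz with rfl | hz
          · rfl
          · exact absurd ((List.pairwise_cons.1 hl.2).1 z hz) h₁.not_gt
        subst hyz
        rw [hzA] at ih'
        simp only [hP, if_true, hxA, hzA, List.cons_append, List.nil_append,
          runs_cons_cons_of_ne hAB, runs_cons_cons_of_ne hAB.symm, runs_cons_cons_self,
          List.countP_cons, decide_true] at ih' ⊢
        omega
      · simp only [hP, if_false, List.cons_append, List.nil_append, List.countP_cons (a := x),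
          decide_false]
        by_cases hxy : lab x = lab y
        · rw [hxy, runs_cons_cons_self, runs_cons_cons_self]
          simpa using ih'
        · rw [runs_cons_cons_of_ne hxy, runs_cons_cons_of_ne hxy]
          simp
          omega

end Runs

/-! ### Runs of the Burrows–Wheeler transform -/

section BWT

variable {α β : Type*} [LinearOrder α] [LinearOrder β]

lemma pairwise_sortedRotations (w : List α) : (sortedRotations w).Pairwise (· ≤ ·) :=
  List.pairwise_insertionSort _ _

lemma mem_sortedRotations {w x : List α} (hw : w ≠ []) : x ∈ sortedRotations w ↔ x ~r w := by
  rw [sortedRotations, (List.perm_insertionSort _ _).mem_iff, List.isRotated_comm]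
  simp only [List.mem_map, List.mem_range]
  constructor
  · rintro ⟨i, -, h⟩
    exact ⟨i, h⟩
  · rintro ⟨i, h⟩
    exact ⟨i % w.length, Nat.mod_lt _ (List.length_pos_iff.2 hw), by rw [List.rotate_mod, h]⟩

lemma r_eq_runs {w : List α} (hw : w ≠ []) :
    r (FreeMonoid.ofList w) = runs ((sortedRotations w).map List.getLast?) := by
  have h : ∀ l : List (List α), (∀ x ∈ l, x ≠ []) →
      l.map List.getLast? = (l.filterMap List.getLast?).map some := by
    intro l hl
    induction l with
    | nil => rfl
    | cons x l ih =>
      have hx : x.getLast? = some (x.getLast (hl x (by simp))) :=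
        List.getLast?_eq_some_getLast _
      rw [List.filterMap_cons_some hx, List.map_cons, List.map_cons, hx,
        ih fun y hy => hl y (List.mem_cons_of_mem _ hy)]
  rw [h _ fun x hx => ?_, runs_map_of_injective (Option.some_injective _), r, length_rle]
  · rfl
  · rintro rfl
    exact hw (by simpa using (mem_sortedRotations hw).1 hx)

lemma runs_map_getLast?_le_r {w : List α} (hw : w ≠ []) {l : List (List α)}
    (hl : l.Pairwise (· ≤ ·)) (h : ∀ x ∈ l, x ~r w) :
    runs (l.map List.getLast?) ≤ r (FreeMonoid.ofList w) := by
  rw [r_eq_runs hw]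
  exact runs_map_le_of_subset _ hl (pairwise_sortedRotations w)
    fun x hx => (mem_sortedRotations hw).2 (h x hx)

lemma r_le_of_isRotated {w w' : List α} (h : w ~r w') :
    r (FreeMonoid.ofList w) ≤ r (FreeMonoid.ofList w') := by
  by_cases hw : w = []
  · subst hw
    rw [← List.isRotated_nil_iff'.1 h]
  · have hw' : w' ≠ [] := by
      rintro rfl
      exact hw (List.isRotated_nil_iff.1 h)
    rw [r_eq_runs hw]
    exact runs_map_getLast?_le_r hw' (pairwise_sortedRotations w)
      fun x hx => ((mem_sortedRotations hw).1 hx).trans h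

end BWT

/-! ### Lexicographic order -/

section Lex

variable {α : Type*} [LinearOrder α]

lemma append_lt_append_of_lt (c : List α) {x y : α} (h : x < y) (s t : List α) :
    c ++ x :: s < c ++ y :: t := by
  induction c with
  | nil => exact List.cons_lt_cons_iff.2 (Or.inl h)
  | cons z c ih => exact List.cons_lt_cons_iff.2 (Or.inr ⟨rfl, ih⟩)

lemma exists_append_of_lt {l m : List α} (hlen : l.length = m.length) (h : l < m) :
    ∃ c x y s t, x < y ∧ l = c ++ x :: s ∧ m = c ++ y :: t := by
  induction l generalizing m with
  | nil =>
    obtain rfl : m = [] := List.length_eq_zero_iff.1 hlen.symm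
    exact absurd h (lt_irrefl _)
  | cons x l ih =>
    cases m with
    | nil => simp at hlen
    | cons y m =>
      rcases List.cons_lt_cons_iff.1 h with h | ⟨rfl, h'⟩
      · exact ⟨[], x, y, l, m, h, rfl, rfl⟩
      · obtain ⟨c, x', y', s, t, hxy, rfl, rfl⟩ := ih (by simpa using hlen) h'
        exact ⟨x :: c, x', y', s, t, hxy, rfl, rfl⟩

lemma exists_append_of_ne {l m : List α} (hlen : l.length = m.length) (h : l ≠ m) :
    ∃ c x y s t, x ≠ y ∧ l = c ++ x :: s ∧ m = c ++ y :: t := by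
  rcases lt_or_gt_of_ne h with h | h
  · obtain ⟨c, x, y, s, t, hxy, h₁, h₂⟩ := exists_append_of_lt hlen h
    exact ⟨c, x, y, s, t, hxy.ne, h₁, h₂⟩
  · obtain ⟨c, x, y, s, t, hxy, h₁, h₂⟩ := exists_append_of_lt hlen.symm h
    exact ⟨c, y, x, t, s, hxy.ne', h₂, h₁⟩

end Lex

/-! ### Conjugate words -/

section Conjugate

variable {α β : Type*}

lemma isRotated_iff_exists_append {l m : List α} :
    l ~r m ↔ ∃ s t, l = s ++ t ∧ m = t ++ s := by
  constructor
  · intro h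
    obtain ⟨n, hn, rfl⟩ := List.isRotated_iff_mod.1 h
    exact ⟨l.take n, l.drop n, (List.take_append_drop n l).symm,
      List.rotate_eq_drop_append_take hn⟩
  · rintro ⟨s, t, rfl, rfl⟩
    exact List.isRotated_append

lemma isRotated_flatMap {l m : List α} (h : l ~r m) (f : α → List β) :
    l.flatMap f ~r m.flatMap f := by
  obtain ⟨s, t, rfl, rfl⟩ := isRotated_iff_exists_append.1 h
  rw [List.flatMap_append, List.flatMap_append]
  exact List.isRotated_append

lemma isRotated_of_append_eq_append {s l m : List α} (h : s ++ l = m ++ s) : l ~r m := by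
  induction hn : s.length using Nat.strong_induction_on generalizing s with
  | _ n ih =>
    rcases List.append_eq_append_iff.1 h with ⟨t, rfl, rfl⟩ | ⟨t, rfl, h'⟩
    · exact List.isRotated_append
    · rcases m.eq_nil_or_concat with rfl | ⟨m', x, rfl⟩
      · have : l = [] := by simpa using h
        rw [this]
      · refine ih t.length ?_ ?_ rfl
        · rw [← hn, List.length_append, List.length_concat]
          omega
        · exact h'.symm

end Conjugate

/-! ### Binary morphisms that do not commute -/

section Morphism

variable {Γ : Type*}

lemma ne_nil_of_not_commute {f : Binary → List Γ} (hf : f 0 ++ f 1 ≠ f 1 ++ f 0) (i : Binary) :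
    f i ≠ [] := by
  intro h
  fin_cases i <;> simp_all

/-- The longest common prefix `t` of `f 0 ++ f 1` and `f 1 ++ f 0` is followed in `f i ++ t` by a
letter `c i` that determines `i`. -/
lemma exists_prefix_append [LinearOrder Γ] {f : Binary → List Γ} (hf : f 0 ++ f 1 ≠ f 1 ++ f 0) :
    ∃ (t : List Γ) (c : Binary → Γ), c 0 ≠ c 1 ∧ t.length < (f 0).length + (f 1).length ∧
      ∀ i, t ++ [c i] <+: f i ++ t := by
  obtain ⟨t, x, y, s, s', hxy, h₀, h₁⟩ := exists_append_of_ne (by simp [Nat.add_comm]) hf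
  have hlen := congrArg List.length h₀
  simp only [List.length_append, List.length_cons] at hlen
  have key : ∀ u v : List Γ, ∀ x y s s', u ≠ [] → u ++ v = t ++ x :: s → v ++ u = t ++ y :: s' →
      t ++ [x] <+: u ++ t := by
    intro u v x y s s' hu h h'
    have hu' := List.length_pos_iff.2 hu
    have h₁ : t ++ [x] <+: u ++ v ++ u := by
      rw [h]
      exact ⟨s ++ u, by simp⟩
    have h₂ : u ++ t <+: u ++ v ++ u := by
      rw [List.append_assoc, h']
      exact ⟨y :: s', by simp⟩
    exact List.prefix_of_prefix_length_le h₁ h₂ (by simp; omega)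
  refine ⟨t, ![x, y], hxy, by omega, fun i => ?_⟩
  fin_cases i
  · exact key _ _ _ _ _ _ (ne_nil_of_not_commute hf 0) h₀ h₁
  · exact key _ _ _ _ _ _ (ne_nil_of_not_commute hf 1) h₁ h₀

lemma prefix_flatMap_append {f : Binary → List Γ} {t : List Γ} {c : Binary → Γ}
    (h : ∀ i, t ++ [c i] <+: f i ++ t) (i : Binary) (l : List Binary) :
    t ++ [c i] <+: (i :: l).flatMap f ++ t := by
  have hl : t <+: l.flatMap f ++ t := by
    induction l with
    | nil => simp
    | cons j l ih =>
      rw [List.flatMap_cons, List.append_assoc]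
      exact ((List.prefix_append _ _).trans (h j)).trans ((List.prefix_append_right_inj _).2 ih)
  rw [List.flatMap_cons, List.append_assoc]
  exact (h i).trans ((List.prefix_append_right_inj _).2 hl)

/-- The images of two distinct conjugate words first differ where one has `c 0` and the other
`c 1`, so the morphism is strictly monotone or strictly antitone on each conjugacy class. -/
lemma exists_flatMap_eq_of_lt {f : Binary → List Γ} {t : List Γ} {c : Binary → Γ}
    (ht : t.length < (f 0).length + (f 1).length)
    (h : ∀ i, t ++ [c i] <+: f i ++ t) {x y : List Binary} (hp : x.Perm y) (hxy : x < y) :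
    ∃ p s s', x.flatMap f = p ++ c 0 :: s ∧ y.flatMap f = p ++ c 1 :: s' := by
  obtain ⟨p, i, j, s, s', hij, rfl, rfl⟩ := exists_append_of_lt hp.length_eq hxy
  obtain ⟨rfl, rfl⟩ : i = 0 ∧ j = 1 :=
    (by decide : ∀ i j : Binary, i < j → i = 0 ∧ j = 1) i j hij
  rw [List.perm_append_left_iff] at hp
  have key : ∀ i j : Binary, ∀ s, i ≠ j → j ∈ s → ∃ q, (i :: s).flatMap f = t ++ c i :: q := by
    intro i j s hij hj
    obtain ⟨s₁, s₂, rfl⟩ := List.append_of_mem hj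
    have hlen : (f 0).length + (f 1).length ≤ ((i :: (s₁ ++ j :: s₂)).flatMap f).length := by
      have : (f 0).length + (f 1).length = (f i).length + (f j).length := by
        revert hij
        fin_cases i <;> fin_cases j <;> simp [Nat.add_comm]
      rw [this]
      simp only [List.flatMap_cons, List.flatMap_append, List.length_append]
      omega
    obtain ⟨q, hq⟩ := List.prefix_of_prefix_length_le (prefix_flatMap_append h i (s₁ ++ j :: s₂))
      (List.prefix_append _ t) (by simp only [List.length_append, List.length_singleton]; omega)
    exact ⟨q, by rw [← hq]; simp⟩
  have h₁ : (1 : Binary) ∈ s := by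
    have : (1 : Binary) ∈ 0 :: s := hp.mem_iff.2 (by simp)
    simpa using this
  have h₀ : (0 : Binary) ∈ s' := by
    have : (0 : Binary) ∈ 1 :: s' := hp.mem_iff.1 (by simp)
    simpa using this
  obtain ⟨q, hq⟩ := key 0 1 s (by decide) h₁
  obtain ⟨q', hq'⟩ := key 1 0 s' (by decide) h₀
  exact ⟨p.flatMap f ++ t, q, q', by rw [List.flatMap_append, hq, List.append_assoc],
    by rw [List.flatMap_append, hq', List.append_assoc]⟩

/-- A noncommuting pair of words can be conjugated so that the two words end in distinct
letters. -/
lemma exists_conjugate_getLast?_ne [LinearOrder Γ] {f : Binary → List Γ}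
    (hf : f 0 ++ f 1 ≠ f 1 ++ f 0) :
    ∃ (s : List Γ) (g : Binary → List Γ) (d : Binary → Γ), d 0 ≠ d 1 ∧
      (∀ i, s ++ f i = g i ++ s) ∧ ∀ i, (g i).getLast? = some (d i) := by
  obtain ⟨t, d, hd, -, h⟩ := exists_prefix_append (f := fun i => (f i).reverse) (by
    intro h
    rw [← List.reverse_append, ← List.reverse_append, List.reverse_inj] at h
    exact hf h.symm)
  choose q hq using h
  refine ⟨t.reverse, fun i => (q i).reverse ++ [d i], d, hd, fun i => ?_, fun i => by simp⟩
  have := congrArg List.reverse (hq i)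
  simpa using this.symm

/-- If the two images end in distinct letters, the last letters of the images of the sorted
rotations of `z` spell a recoding of `bwt z`, forwards or backwards. -/
lemma r_le_r_flatMap_of_getLast?_ne [LinearOrder Γ] {g : Binary → List Γ} {d : Binary → Γ}
    (hd : d 0 ≠ d 1) (hg : ∀ i, (g i).getLast? = some (d i)) (z : List Binary) :
    r (FreeMonoid.ofList z) ≤ r (FreeMonoid.ofList (z.flatMap g)) := by
  have hcomm : g 0 ++ g 1 ≠ g 1 ++ g 0 := by
    intro h
    have := congrArg List.getLast? h
    rw [List.getLast?_append, List.getLast?_append, hg, hg] at this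
    exact hd (by simpa using this.symm)
  by_cases hz : z = []
  · subst hz
    exact Nat.zero_le _
  have hgz : z.flatMap g ≠ [] := by
    obtain ⟨i, z', rfl⟩ := List.exists_cons_of_ne_nil hz
    simp [ne_nil_of_not_commute hcomm i]
  have hdinj : Function.Injective d := by
    intro i j h
    fin_cases i <;> fin_cases j <;> simp_all
  have hlast : ∀ x : List Binary, (x.flatMap g).getLast? = x.getLast?.map d := by
    intro x
    rcases x.eq_nil_or_concat with rfl | ⟨x, i, rfl⟩
    · rfl
    · simp [List.getLast?_append, hg]
  have hlab : ((sortedRotations z).map (List.flatMap g)).map List.getLast?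
      = ((sortedRotations z).map List.getLast?).map (Option.map d) := by
    simp [hlast]
  obtain ⟨t, c, hc, ht, h⟩ := exists_prefix_append hcomm
  have hrot : ∀ x ∈ sortedRotations z, x ~r z := fun x hx => (mem_sortedRotations hz).1 hx
  have hS := (pairwise_sortedRotations z).imp_of_mem fun {x y} hx hy hxy =>
    And.intro ((hrot x hx).perm.trans (hrot y hy).perm.symm) (lt_or_eq_of_le hxy)
  have hrot' : ∀ x ∈ (sortedRotations z).map (List.flatMap g), x ~r z.flatMap g := by
    intro x hx
    obtain ⟨y, hy, rfl⟩ := List.mem_map.1 hx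
    exact isRotated_flatMap (hrot y hy) g
  rw [r_eq_runs hz, ← runs_map_of_injective (Option.map_injective hdinj), ← hlab]
  rcases lt_or_gt_of_ne hc with hlt | hgt
  · refine runs_map_getLast?_le_r hgz ?_ hrot'
    rw [List.pairwise_map]
    refine hS.imp ?_
    rintro x y ⟨hp, hxy | rfl⟩
    · obtain ⟨p, s, s', h₁, h₂⟩ := exists_flatMap_eq_of_lt ht h hp hxy
      rw [h₁, h₂]
      exact (append_lt_append_of_lt p hlt s s').le
    · exact le_rfl
  · refine (runs_le_runs_reverse _).trans ?_
    rw [← List.map_reverse]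
    refine runs_map_getLast?_le_r hgz ?_ fun x hx => hrot' x (List.mem_reverse.1 hx)
    rw [List.pairwise_reverse, List.pairwise_map]
    refine hS.imp ?_
    rintro x y ⟨hp, hxy | rfl⟩
    · obtain ⟨p, s, s', h₁, h₂⟩ := exists_flatMap_eq_of_lt ht h hp hxy
      rw [h₁, h₂]
      exact (append_lt_append_of_lt p hgt s' s).le
    · exact le_rfl

/-- A binary morphism whose images do not commute does not decrease the number of runs. -/
theorem r_le_r_flatMap [LinearOrder Γ] {f : Binary → List Γ} (hf : f 0 ++ f 1 ≠ f 1 ++ f 0)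
    (z : List Binary) : r (FreeMonoid.ofList z) ≤ r (FreeMonoid.ofList (z.flatMap f)) := by
  obtain ⟨s, g, d, hd, hs, hg⟩ := exists_conjugate_getLast?_ne hf
  have h : s ++ z.flatMap f = z.flatMap g ++ s := by
    induction z with
    | nil => simp
    | cons i z ih =>
      rw [List.flatMap_cons, List.flatMap_cons, ← List.append_assoc, hs, List.append_assoc, ih,
        List.append_assoc]
  exact (r_le_r_flatMap_of_getLast?_ne hd hg z).trans
    (r_le_of_isRotated (isRotated_of_append_eq_append h).symm)

end Morphism

/-! ### Forcing new runs between consecutive rotations -/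

/-- Suppose `φ` embeds the rotations of `w` into those of `w'`, respecting order and last letters.
Each rotation `X j` of `w` such that `X j` and the next larger rotation `Y j` both end in `A`, while
some rotation of `w'` between their images ends in `B ≠ A`, contributes two new runs. -/
theorem r_add_two_mul_card_le {ι α : Type*} [LinearOrder α] {w w' : List α} (hw : w ≠ [])
    (hw' : w' ≠ []) {φ : List α → List α} (hφ : ∀ x, x ~r w → φ x ~r w')
    (hmono : ∀ x y, x ~r w → y ~r w → x < y → φ x < φ y)
    (hlast : ∀ x, (φ x).getLast? = x.getLast?) {A B : α} (hAB : A ≠ B)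
    (I : Finset ι) {X Y g : ι → List α} (hXinj : Set.InjOn X I)
    (hX : ∀ j ∈ I, X j ~r w ∧ (X j).getLast? = some A)
    (hY : ∀ j ∈ I, Y j ~r w ∧ (Y j).getLast? = some A)
    (hXY : ∀ j ∈ I, X j < Y j ∧ ∀ z, z ~r w → X j < z → Y j ≤ z)
    (hg : ∀ j ∈ I, g j ~r w' ∧ (g j).getLast? = some B ∧ φ (X j) ≤ g j ∧ g j ≤ φ (Y j)) :
    r (FreeMonoid.ofList w) + 2 * I.card ≤ r (FreeMonoid.ofList w') := by
  classical
  set P : List α → Prop := fun x => ∃ j ∈ I, X j = x with hP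
  obtain ⟨G, hG⟩ : ∃ G : List α → List α, ∀ j ∈ I, G (X j) = g j := by
    refine ⟨fun x => if h : ∃ j ∈ I, X j = x then g h.choose else [], fun j hj => ?_⟩
    have h : ∃ i ∈ I, X i = X j := ⟨j, hj, rfl⟩
    dsimp only
    rw [dif_pos h, hXinj h.choose_spec.1 hj h.choose_spec.2]
  set T := (sortedRotations w).dedup with hT
  have hmem : ∀ x, x ∈ T ↔ x ~r w := fun x => by
    rw [hT, List.mem_dedup, mem_sortedRotations hw]
  have hTle : T.Pairwise (· ≤ ·) := (pairwise_sortedRotations w).sublist (List.dedup_sublist _)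
  have hTlt : T.Pairwise (· < ·) :=
    (hTle.and (List.nodup_dedup _)).imp fun h => lt_of_le_of_ne h.1 h.2
  have hcard : I.card ≤ T.countP P := by
    rw [List.countP_eq_length_filter, ← Finset.card_image_of_injOn hXinj]
    refine (Finset.card_le_card ?_).trans (List.toFinset_card_le _)
    intro x hx
    obtain ⟨j, hj, rfl⟩ := Finset.mem_image.1 hx
    rw [List.mem_toFinset, List.mem_filter]
    exact ⟨(hmem _).2 (hX j hj).1, decide_eq_true ⟨j, hj, rfl⟩⟩
  have hr : r (FreeMonoid.ofList w) ≤ runs (T.map List.getLast?) := by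
    rw [r_eq_runs hw]
    exact runs_map_le_of_subset _ (pairwise_sortedRotations w) hTle
      fun x hx => List.mem_dedup.2 hx
  have hins := runs_flatMap_insert List.getLast? (A := some A) (B := some B) (by simpa using hAB)
    P hTlt (by
      rintro _ - ⟨j, hj, rfl⟩
      exact ⟨(hX j hj).2, Y j, (hmem _).2 (hY j hj).1, (hXY j hj).1, (hY j hj).2,
        fun z hz => (hXY j hj).2 z ((hmem z).1 hz)⟩)
  set l := T.flatMap fun x => if P x then [φ x, G x] else [φ x] with hl
  have hlab : l.map List.getLast?
      = T.flatMap fun x => if P x then [x.getLast?, some B] else [x.getLast?] := by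
    rw [hl, List.map_flatMap]
    congr 1
    funext x
    by_cases hx : P x
    · obtain ⟨j, hj, rfl⟩ := hx
      have : P (X j) := ⟨j, hj, rfl⟩
      simp [this, hlast, hG j hj, (hg j hj).2.1]
    · simp [hx, hlast]
  have hup : runs (l.map List.getLast?) ≤ r (FreeMonoid.ofList w') := by
    refine runs_map_getLast?_le_r hw' ?_ ?_
    · rw [hl, List.pairwise_flatMap]
      constructor
      · intro x _
        by_cases hx : P x
        · obtain ⟨j, hj, rfl⟩ := hx
          have : P (X j) := ⟨j, hj, rfl⟩
          simpa [this, hG j hj] using (hg j hj).2.2.1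
        · simp [hx]
      · refine hTlt.imp_of_mem ?_
        intro x y hx hy hxy u hu v hv
        rw [hmem] at hx hy
        have hu' : u ≤ φ y := by
          by_cases hPx : P x
          · rw [if_pos hPx] at hu
            obtain ⟨j, hj, rfl⟩ := hPx
            rcases List.mem_pair.1 hu with rfl | rfl
            · exact (hmono _ _ hx hy hxy).le
            · rw [hG j hj]
              refine (hg j hj).2.2.2.trans ?_
              rcases ((hXY j hj).2 y hy hxy).lt_or_eq with h | h
              · exact (hmono _ _ (hY j hj).1 hy h).le
              · rw [h]
          · rw [if_neg hPx, List.mem_singleton] at hu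
            rw [hu]
            exact (hmono _ _ hx hy hxy).le
        refine hu'.trans ?_
        by_cases hPy : P y
        · rw [if_pos hPy] at hv
          obtain ⟨j, hj, rfl⟩ := hPy
          rcases List.mem_pair.1 hv with rfl | rfl
          · exact le_rfl
          · rw [hG j hj]
            exact (hg j hj).2.2.1
        · rw [if_neg hPy, List.mem_singleton] at hv
          rw [hv]
    · intro u hu
      obtain ⟨x, hx, hu⟩ := List.mem_flatMap.1 hu
      rw [hmem] at hx
      by_cases hPx : P x
      · rw [if_pos hPx] at hu
        obtain ⟨j, hj, rfl⟩ := hPx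
        rcases List.mem_pair.1 hu with rfl | rfl
        · exact hφ _ hx
        · rw [hG j hj]
          exact (hg j hj).1
      · rw [if_neg hPx, List.mem_singleton] at hu
        rw [hu]
        exact hφ _ hx
  rw [hlab, hins] at hup
  omega

/-! ### Words with blocks of increasing length -/

/-- The concatenation over `j ∈ L` of the words `b ^ (j + 1) a ^ (e j)`. -/
def spell (e : ℕ → ℕ) (L : List ℕ) : List Binary :=
  L.flatMap fun j => List.replicate (j + 1) 1 ++ List.replicate (e j) 0

/-- The rotation of `spell e [0, …, m - 1]` that starts with the block of index `j`. -/
def blockRotation (e : ℕ → ℕ) (m j : ℕ) : List Binary :=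
  spell e (List.range' j (m - j) ++ List.range' 0 j)

section Spell

variable {e : ℕ → ℕ} {m : ℕ}

lemma spell_append (e : ℕ → ℕ) (L M : List ℕ) : spell e (L ++ M) = spell e L ++ spell e M :=
  List.flatMap_append

lemma spell_cons (e : ℕ → ℕ) (j : ℕ) (L : List ℕ) :
    spell e (j :: L) = List.replicate (j + 1) 1 ++ (List.replicate (e j) 0 ++ spell e L) := by
  simp [spell]

lemma spell_eq_cons {L : List ℕ} (hL : L ≠ []) : ∃ z, spell e L = 1 :: z := by
  obtain ⟨j, L, rfl⟩ := List.exists_cons_of_ne_nil hL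
  exact ⟨_, by rw [spell_cons, List.replicate_succ, List.cons_append]⟩

lemma getLast?_spell {L : List ℕ} (hL : L ≠ []) (he : ∀ j ∈ L, 0 < e j) :
    (spell e L).getLast? = some 0 := by
  rcases L.eq_nil_or_concat with rfl | ⟨L, j, rfl⟩
  · exact absurd rfl hL
  · have h : e j ≠ 0 := (he j (by simp)).ne'
    rw [List.concat_eq_append, spell_append, spell_cons]
    simp [List.getLast?_append, List.getLast?_replicate, h, spell]

lemma isRotated_blockRotation {j : ℕ} (hj : j ≤ m) :
    blockRotation e m j ~r spell e (List.range' 0 m) := by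
  have h : List.range' 0 m = List.range' 0 j ++ List.range' j (m - j) := by
    have := List.range'_append_1 (s := 0) (m := j) (n := m - j)
    rw [Nat.zero_add, Nat.add_sub_cancel' hj] at this
    exact this.symm
  rw [h, blockRotation, spell_append, spell_append]
  exact List.isRotated_append

lemma blockRotation_eq {j : ℕ} (hj : j < m) (hm : 1 < m) :
    ∃ z, blockRotation e m j
      = List.replicate (j + 1) 1 ++ (List.replicate (e j) 0 ++ 1 :: z) := by
  obtain ⟨k, hk⟩ : ∃ k, m - j = k + 1 := ⟨m - j - 1, by omega⟩
  obtain ⟨z, hz⟩ := spell_eq_cons (e := e) (L := List.range' (j + 1) k ++ List.range' 0 j) (by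
    rw [← List.length_pos_iff]
    simp
    omega)
  exact ⟨z, by rw [blockRotation, hk, List.range'_succ, List.cons_append, spell_cons, hz]⟩

lemma getLast?_blockRotation {j : ℕ} (hj : j < m) (he : ∀ i < m, 0 < e i) :
    (blockRotation e m j).getLast? = some 0 := by
  refine getLast?_spell ?_ ?_
  · rw [← List.length_pos_iff]
    simp
    omega
  · intro i hi
    rw [List.mem_append, List.mem_range'_1, List.mem_range'_1] at hi
    exact he i (by omega)

lemma flatMap_eq_append_cases {α β : Type*} {f : α → List β} {l : List α} {s t : List β}
    (h : l.flatMap f = s ++ t) :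
    (∃ L M, l = L ++ M ∧ s = L.flatMap f ∧ t = M.flatMap f) ∨
      ∃ L j M u v, l = L ++ j :: M ∧ f j = u ++ v ∧ u ≠ [] ∧ v ≠ [] ∧
        s = L.flatMap f ++ u ∧ t = v ++ M.flatMap f := by
  induction l generalizing s with
  | nil =>
    obtain ⟨rfl, rfl⟩ := List.append_eq_nil_iff.1 h.symm
    exact Or.inl ⟨[], [], rfl, rfl, rfl⟩
  | cons j l ih =>
    rw [List.flatMap_cons] at h
    rcases List.append_eq_append_iff.1 h with ⟨u, rfl, h'⟩ | ⟨v, h', rfl⟩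
    · rcases ih h' with ⟨L, M, rfl, rfl, rfl⟩ | ⟨L, k, M, u, v, rfl, hk, hu, hv, rfl, rfl⟩
      · exact Or.inl ⟨j :: L, M, rfl, rfl, rfl⟩
      · exact Or.inr ⟨j :: L, k, M, u, v, rfl, hk, hu, hv, by simp, rfl⟩
    · by_cases hs : s = []
      · subst hs
        exact Or.inl ⟨[], j :: l, rfl, rfl, by simp [h]⟩
      by_cases hv : v = []
      · subst hv
        exact Or.inl ⟨[j], l, rfl, by simpa using h'.symm, by simp⟩
      exact Or.inr ⟨[], j, l, s, v, rfl, h', hs, hv, rfl, rfl⟩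

/-- A rotation of `spell e [0, …, m - 1]` starts with `a`, or at the beginning of a block of letters
`b`, or strictly inside such a block. -/
lemma isRotated_spell_cases (hm : 1 < m) {y : List Binary}
    (hy : y ~r spell e (List.range' 0 m)) :
    (∃ z, y = 0 :: z) ∨ ∃ j < m, y = blockRotation e m j ∨
      ∃ i < j, ∃ z, y = List.replicate (i + 1) 1 ++ (List.replicate (e j) 0 ++ 1 :: z) := by
  obtain ⟨t, s, rfl, hst⟩ := isRotated_iff_exists_append.1 hy
  rcases flatMap_eq_append_cases hst with ⟨L, M, hLM, rfl, rfl⟩ |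
    ⟨L, j, M, u, v, hLM, hj, hu, hv, rfl, rfl⟩
  · obtain ⟨k, hk, rfl, rfl⟩ := List.range'_eq_append_iff.1 hLM
    right
    rcases hk.lt_or_eq with hk | rfl
    · exact ⟨k, hk, Or.inl (by simp [blockRotation, spell])⟩
    · exact ⟨0, by omega, Or.inl (by simp [blockRotation, spell])⟩
  · have hlen := congrArg List.length hLM
    have hjm : j ∈ List.range' 0 m := by simp [hLM]
    rw [List.mem_range'_1] at hjm
    obtain ⟨z, hz⟩ := spell_eq_cons (e := e) (L := M ++ L) (by
      rw [← List.length_pos_iff]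
      simp at hlen ⊢
      omega)
    have hy : ∀ v, v ++ M.flatMap (fun j => List.replicate (j + 1) 1 ++ List.replicate (e j) 0) ++
        (L.flatMap (fun j => List.replicate (j + 1) 1 ++ List.replicate (e j) 0) ++ u)
        = v ++ 1 :: (z ++ u) := by
      intro v
      rw [← List.cons_append, ← hz, spell_append]
      simp [spell]
    rw [hy]
    have hzero : ∀ v w : List Binary, v ≠ [] → List.replicate (e j) 0 = w ++ v →
        ∃ z, v = 0 :: z := by
      intro v w hv h
      obtain ⟨x, v, rfl⟩ := List.exists_cons_of_ne_nil hv
      have : x = 0 := List.eq_of_mem_replicate (n := e j) (by simp [h])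
      exact ⟨v, by rw [this]⟩
    rcases List.append_eq_append_iff.1 hj with ⟨w, -, h⟩ | ⟨w, h, rfl⟩
    · obtain ⟨z, rfl⟩ := hzero v w hv h
      exact Or.inl ⟨_, rfl⟩
    · obtain ⟨hl, -, hw⟩ := List.replicate_eq_append_iff.1 h
      by_cases hw0 : w = []
      · subst hw0
        obtain ⟨z, hz⟩ := hzero _ [] hv rfl
        exact Or.inl ⟨_, by rw [hz]; rfl⟩
      · refine Or.inr ⟨j, by omega, Or.inr ⟨w.length - 1, ?_, z ++ u, ?_⟩⟩
        · have := List.length_pos_iff.2 hu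
          have := List.length_pos_iff.2 hw0
          omega
        · rw [Nat.sub_add_cancel (List.length_pos_iff.2 hw0), ← hw, List.append_assoc]

lemma replicate_append_lt_of_lt {i k : ℕ} (h : i < k) (s t : List Binary) :
    List.replicate i 1 ++ 0 :: s < List.replicate k 1 ++ t := by
  obtain ⟨d, rfl⟩ := Nat.exists_eq_add_of_lt h
  rw [Nat.add_assoc, List.replicate_add, List.append_assoc, List.replicate_succ]
  exact append_lt_append_of_lt _ (show (0 : Binary) < 1 by decide) _ _

lemma append_replicate_lt_of_lt {i k : ℕ} (h : i < k) (c s t : List Binary) :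
    c ++ (List.replicate k 0 ++ t) < c ++ (List.replicate i 0 ++ 1 :: s) := by
  obtain ⟨d, rfl⟩ := Nat.exists_eq_add_of_lt h
  rw [Nat.add_assoc, List.replicate_add, List.append_assoc, List.replicate_succ,
    List.cons_append, ← List.append_assoc, ← List.append_assoc]
  exact append_lt_append_of_lt _ (show (0 : Binary) < 1 by decide) _ _

lemma blockRotation_eq_zero {j : ℕ} (hj : j < m) (hm : 1 < m) (he : ∀ i < m, 0 < e i) :
    ∃ z, blockRotation e m j = List.replicate (j + 1) 1 ++ 0 :: z := by
  obtain ⟨z, hz⟩ := blockRotation_eq (e := e) hj hm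
  obtain ⟨n, hn⟩ := Nat.exists_eq_succ_of_ne_zero (he j hj).ne'
  rw [hn, List.replicate_succ] at hz
  exact ⟨_, hz⟩

lemma blockRotation_lt_blockRotation (hm : 1 < m) (he : ∀ i < m, 0 < e i) {i j : ℕ} (hij : i < j)
    (hj : j < m) : blockRotation e m i < blockRotation e m j := by
  obtain ⟨z, hz⟩ := blockRotation_eq_zero (e := e) (hij.trans hj) hm he
  obtain ⟨z', hz'⟩ := blockRotation_eq (e := e) hj hm
  rw [hz, hz']
  exact replicate_append_lt_of_lt (by omega) _ _

/-- If `e j` is smaller, and `e (j + 1)` is larger, than all later exponents, then the rotation at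
block `j` is the largest with prefix `b ^ (j + 1) a`, and the rotation at block `j + 1` is the
smallest with prefix `b ^ (j + 2)`, so that the two are consecutive. -/
lemma blockRotation_succ_le (he : ∀ i < m, 0 < e i) {j : ℕ} (hj : j + 1 < m)
    (hmin : ∀ i < m, j < i → e j < e i) (hmax : ∀ i < m, j + 1 < i → e i < e (j + 1))
    {y : List Binary} (hy : y ~r spell e (List.range' 0 m)) (hlt : blockRotation e m j < y) :
    blockRotation e m (j + 1) ≤ y := by
  have hm : 1 < m := by omega
  obtain ⟨x, hx⟩ := blockRotation_eq (e := e) (show j < m by omega) hm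
  obtain ⟨x', hx'⟩ := blockRotation_eq_zero (e := e) hj hm he
  obtain ⟨x'', hx''⟩ := blockRotation_eq (e := e) hj hm
  rcases isRotated_spell_cases hm hy with ⟨z, rfl⟩ | ⟨k, hk, rfl | ⟨i, hik, z, rfl⟩⟩
  · rw [hx] at hlt
    exact absurd hlt (replicate_append_lt_of_lt (i := 0) (Nat.succ_pos j) z _).not_gt
  · rcases lt_trichotomy k j with h | rfl | h
    · exact absurd hlt (blockRotation_lt_blockRotation hm he h (by omega)).not_gt
    · exact absurd hlt (lt_irrefl _)
    · rcases (Nat.succ_le_of_lt h).lt_or_eq with h | rfl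
      · exact (blockRotation_lt_blockRotation hm he h hk).le
      · exact le_rfl
  · rcases lt_trichotomy i j with h | rfl | h
    · obtain ⟨n, hn⟩ := Nat.exists_eq_succ_of_ne_zero (he k hk).ne'
      rw [hx, hn, List.replicate_succ (n := n)] at hlt
      exact absurd hlt (replicate_append_lt_of_lt (by omega) _ _).not_gt
    · rw [hx] at hlt
      exact absurd hlt (append_replicate_lt_of_lt (hmin k hk hik) _ _ _).not_gt
    · rcases (Nat.succ_le_of_lt h).lt_or_eq with h | rfl
      · rw [hx']
        exact (replicate_append_lt_of_lt (by omega) _ _).le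
      · rw [hx'']
        exact (append_replicate_lt_of_lt (hmax k hk hik) _ _ _).le

end Spell

/-! ### The morphism `(a, b ^ p)` -/

/-- `rho p` on lists: the word `l` with each `b` repeated `p` times. -/
def rhoList (p : ℕ) (l : List Binary) : List Binary :=
  l.flatMap ![[0], List.replicate p 1]

section Rho

variable {p : ℕ}

lemma rhoList_append (p : ℕ) (s t : List Binary) :
    rhoList p (s ++ t) = rhoList p s ++ rhoList p t := List.flatMap_append

lemma rhoList_replicate_one (p k : ℕ) :
    rhoList p (List.replicate k 1) = List.replicate (p * k) 1 := by
  induction k with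
  | zero => rfl
  | succ k ih =>
    rw [List.replicate_succ', rhoList_append, ih, Nat.mul_succ, List.replicate_add]
    simp [rhoList]

lemma rhoList_cons_zero (p : ℕ) (l : List Binary) : rhoList p (0 :: l) = 0 :: rhoList p l := rfl

lemma rhoList_cons_one (hp : 0 < p) (l : List Binary) : ∃ z, rhoList p (1 :: l) = 1 :: z := by
  obtain ⟨q, rfl⟩ := Nat.exists_eq_succ_of_ne_zero hp.ne'
  exact ⟨List.replicate q 1 ++ rhoList (q + 1) l, rfl⟩

lemma rhoList_lt_rhoList (hp : 0 < p) {x y : List Binary} (hlen : x.length = y.length)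
    (h : x < y) : rhoList p x < rhoList p y := by
  obtain ⟨c, i, j, s, t, hij, rfl, rfl⟩ := exists_append_of_lt hlen h
  obtain ⟨rfl, rfl⟩ : i = 0 ∧ j = 1 :=
    (by decide : ∀ i j : Binary, i < j → i = 0 ∧ j = 1) i j hij
  obtain ⟨z, hz⟩ := rhoList_cons_one hp t
  rw [rhoList_append, rhoList_append, hz, rhoList_cons_zero]
  exact append_lt_append_of_lt _ hij _ _

lemma getLast?_rhoList (hp : 0 < p) (x : List Binary) :
    (rhoList p x).getLast? = x.getLast? := by
  rcases x.eq_nil_or_concat with rfl | ⟨x, i, rfl⟩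
  · rfl
  · rw [List.concat_eq_append, rhoList_append]
    fin_cases i <;> simp [rhoList, List.getLast?_append, List.getLast?_replicate, hp.ne']

/-- Each index `j ∈ I` as in `blockRotation_succ_le` yields two new runs in the image under
`rho p`: the rotation with prefix `b ^ (p * (j + 1) + 1) a` falls between the images of the two
consecutive rotations at the blocks `j` and `j + 1`, and it ends in `b` because `p > 1`. -/
theorem r_spell_add_two_mul_card_le (hp : 1 < p) {e : ℕ → ℕ} {m : ℕ} (hm : 1 < m)
    (he : ∀ i < m, 0 < e i) (I : Finset ℕ)
    (hI : ∀ j ∈ I, j + 1 < m ∧ (∀ i < m, j < i → e j < e i) ∧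
      ∀ i < m, j + 1 < i → e i < e (j + 1)) :
    r (FreeMonoid.ofList (spell e (List.range' 0 m))) + 2 * I.card
      ≤ r (FreeMonoid.ofList (rhoList p (spell e (List.range' 0 m)))) := by
  set w := spell e (List.range' 0 m) with hw
  have hp0 : 0 < p := by omega
  obtain ⟨z₀, hz₀⟩ := spell_eq_cons (e := e) (L := List.range' 0 m) (by
    rw [← List.length_pos_iff]
    simp
    omega)
  have hw0 : w ≠ [] := by simp [hw, hz₀]
  have hw0' : rhoList p w ≠ [] := by
    obtain ⟨z, hz⟩ := rhoList_cons_one hp0 z₀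
    simp [hw, hz₀, hz]
  -- The intermediate rotation starts after the first `p - 1` letters of the image of block `j + 1`.
  have hG : ∀ j, ∃ g : List Binary, j ∈ I → g ~r rhoList p w ∧ g.getLast? = some 1 ∧
      rhoList p (blockRotation e m j) ≤ g ∧ g ≤ rhoList p (blockRotation e m (j + 1)) := by
    intro j
    by_cases hj : j ∈ I
    swap
    · exact ⟨[], fun h => absurd h hj⟩
    have hjm := (hI j hj).1
    obtain ⟨x, hx⟩ := blockRotation_eq_zero (e := e) (show j < m by omega) hm he
    obtain ⟨y, hy⟩ := blockRotation_eq_zero (e := e) hjm hm he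
    have hy' : rhoList p (blockRotation e m (j + 1)) = List.replicate (p - 1) 1 ++
        (List.replicate (p * (j + 1) + 1) 1 ++ 0 :: rhoList p y) := by
      rw [hy, rhoList_append, rhoList_replicate_one, rhoList_cons_zero, ← List.append_assoc,
        ← List.replicate_add, Nat.mul_succ p (j + 1)]
      congr 2
      omega
    refine ⟨List.replicate (p * (j + 1) + 1) 1 ++ 0 :: rhoList p y ++ List.replicate (p - 1) 1,
      fun _ => ⟨?_, ?_, ?_, ?_⟩⟩
    · refine List.IsRotated.trans ?_ (isRotated_flatMap (isRotated_blockRotation hjm.le) _)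
      change _ ~r rhoList p _
      rw [hy']
      exact List.isRotated_append
    · have : p - 1 ≠ 0 := by omega
      rw [List.getLast?_append, List.getLast?_replicate, if_neg this]
      rfl
    · rw [hx, rhoList_append, rhoList_replicate_one, rhoList_cons_zero, List.append_assoc]
      exact (replicate_append_lt_of_lt (Nat.lt_succ_self _) _ _).le
    · rw [hy', ← List.append_assoc, ← List.replicate_add, List.append_assoc, List.cons_append]
      exact (replicate_append_lt_of_lt (by omega) _ _).le
  choose g hg using hG
  refine r_add_two_mul_card_le (X := blockRotation e m) (Y := fun j => blockRotation e m (j + 1))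
    (g := g) (φ := rhoList p) (A := (0 : Binary)) (B := 1) hw0 hw0'
    (fun x hx => isRotated_flatMap hx _)
    (fun x y hx hy hxy => rhoList_lt_rhoList hp0 (hx.perm.trans hy.perm.symm).length_eq hxy)
    (getLast?_rhoList hp0) (by decide) I ?_ (fun j hj => ?_) (fun j hj => ?_) (fun j hj => ?_) hg
  · intro i hi j hj hij
    have hi' := (hI i hi).1
    have hj' := (hI j hj).1
    rcases lt_trichotomy i j with h | h | h
    · exact absurd hij (blockRotation_lt_blockRotation hm he h (by omega)).ne
    · exact h
    · exact absurd hij (blockRotation_lt_blockRotation hm he h (by omega)).ne'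
  · have := (hI j hj).1
    exact ⟨isRotated_blockRotation (by omega), getLast?_blockRotation (by omega) he⟩
  · have := (hI j hj).1
    exact ⟨isRotated_blockRotation (by omega), getLast?_blockRotation (by omega) he⟩
  · obtain ⟨h₁, h₂, h₃⟩ := hI j hj
    exact ⟨blockRotation_lt_blockRotation hm he (Nat.lt_succ_self j) h₁,
      fun z hz hlt => blockRotation_succ_le he h₁ h₂ h₃ hz hlt⟩

end Rho

/-! ### The lower bound for `rho p` -/

/-- Exponents that make every odd block index `j` usable in `blockRotation_succ_le`: the values
`1, 3, 5, …` at odd indices ascend and stay below the values `2m - 2, 2m - 4, …` at even ones. The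
value `P` at `0` is free, and is used to adjust the length. -/
def zigzag (m P j : ℕ) : ℕ :=
  if j = 0 then P else if j % 2 = 0 then 2 * m - j else j

lemma zigzag_of_odd {m P j : ℕ} (h : j % 2 = 1) : zigzag m P j = j := by
  rw [zigzag, if_neg (by omega), if_neg (by omega)]

lemma zigzag_of_even {m P j : ℕ} (h : j % 2 = 0) (h0 : j ≠ 0) : zigzag m P j = 2 * m - j := by
  rw [zigzag, if_neg h0, if_pos h]

lemma length_spell_le {e : ℕ → ℕ} {B : ℕ} (L : List ℕ) (h : ∀ j ∈ L, j + 1 + e j ≤ B) :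
    (spell e L).length ≤ L.length * B := by
  induction L with
  | nil => simp [spell]
  | cons j L ih =>
    have h₁ := h j (by simp)
    have h₂ := ih fun i hi => h i (List.mem_cons_of_mem _ hi)
    rw [spell_cons, List.length_cons, Nat.succ_mul]
    simp only [List.length_append, List.length_replicate]
    omega

/-- Padding at block `0` gives the length `n`. -/
lemma exists_length_spell_zigzag_eq {m n : ℕ} (hm : 0 < m) (hn : 3 * m * m < n) :
    ∃ P, 0 < P ∧ (spell (zigzag m P) (List.range' 0 m)).length = n := by
  obtain ⟨k, rfl⟩ := Nat.exists_eq_succ_of_ne_zero hm.ne'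
  set R := List.range' 1 k with hR
  have hmem : ∀ j ∈ R, 1 ≤ j ∧ j < k.succ := fun j hj => by
    rw [hR, List.mem_range'_1] at hj
    omega
  have hlen : ∀ P, (spell (zigzag k.succ P) (List.range' 0 k.succ)).length
      = 1 + P + (spell (zigzag k.succ 0) R).length := by
    intro P
    have h : spell (zigzag k.succ P) R = spell (zigzag k.succ 0) R := by
      refine List.flatMap_congr fun j hj => ?_
      have : j ≠ 0 := by have := hmem j hj; omega
      simp [zigzag, this]
    change (spell _ (0 :: R)).length = _
    rw [spell_cons, h]
    simp [zigzag]
    omega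
  have hR' : (spell (zigzag k.succ 0) R).length ≤ k * (3 * k.succ) := by
    have h := length_spell_le (e := zigzag k.succ 0) (B := 3 * k.succ) R (fun j hj => by
      have := hmem j hj
      unfold zigzag
      split_ifs <;> omega)
    rwa [hR, List.length_range', ← hR] at h
  have : 3 * k.succ * k.succ = k * (3 * k.succ) + 3 * k.succ := by
    rw [Nat.succ_eq_add_one]
    ring
  exact ⟨n - 1 - (spell (zigzag k.succ 0) R).length, by omega, by rw [hlen]; omega⟩

/-- Quadratic length suffices for `2 * K` new runs. -/
lemma exists_r_rhoList_ge {p K n : ℕ} (hp : 1 < p) (hK : 0 < K)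
    (hn : 3 * (2 * K + 1) * (2 * K + 1) < n) :
    ∃ w : List Binary, w.length = n ∧
      r (FreeMonoid.ofList w) + 2 * K ≤ r (FreeMonoid.ofList (rhoList p w)) := by
  obtain ⟨P, hP, hlen⟩ := exists_length_spell_zigzag_eq (Nat.succ_pos (2 * K)) hn
  refine ⟨_, hlen, ?_⟩
  have h := r_spell_add_two_mul_card_le hp (e := zigzag (2 * K + 1) P) (m := 2 * K + 1)
    (by omega) (fun i hi => by unfold zigzag; split_ifs <;> omega)
    ((Finset.range K).image fun i => 2 * i + 1) (by
      intro j hj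
      obtain ⟨i, hi, hij⟩ := Finset.mem_image.1 hj
      rw [Finset.mem_range] at hi
      refine ⟨by omega, fun l hl hjl => ?_, fun l hl hjl => ?_⟩
      · rw [zigzag_of_odd (j := j) (by omega)]
        rcases Nat.mod_two_eq_zero_or_one l with h | h
        · rw [zigzag_of_even h (by omega)]
          omega
        · rw [zigzag_of_odd h]
          omega
      · rw [zigzag_of_even (j := j + 1) (by omega) (by omega)]
        rcases Nat.mod_two_eq_zero_or_one l with h | h
        · rw [zigzag_of_even h (by omega)]
          omega
        · rw [zigzag_of_odd h]
          omega)
  rwa [Finset.card_image_of_injective _ (fun i j h => by simpa using h), Finset.card_range] at h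

lemma eventually_exists_r_rhoList_ge {p : ℕ} (hp : 1 < p) :
    ∃ c : ℝ, 0 < c ∧ ∀ᶠ n : ℕ in Filter.atTop, ∃ w : List Binary, w.length = n ∧
      c * Real.sqrt n ≤
        (r (FreeMonoid.ofList (rhoList p w)) : ℝ) - (r (FreeMonoid.ofList w) : ℝ) := by
  refine ⟨1 / 6, by norm_num, ?_⟩
  filter_upwards [Filter.eventually_ge_atTop 36] with n hn
  -- This choice of `K` gives `36 * K ^ 2 ≤ n < (12 * K) ^ 2`.
  set K := Nat.sqrt n / 6 with hK
  have h6 : 6 ≤ Nat.sqrt n := Nat.le_sqrt.2 (by omega)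
  have hK0 : 0 < K := by omega
  have h₁ : 36 * (K * K) ≤ n := by
    have h : 6 * K ≤ Nat.sqrt n := by omega
    calc 36 * (K * K) = (6 * K) * (6 * K) := by ring
      _ ≤ n := Nat.le_sqrt.1 h
  have h₂ : n < (12 * K) * (12 * K) := Nat.sqrt_lt.1 (by omega)
  obtain ⟨w, hw, hr⟩ := exists_r_rhoList_ge (n := n) hp hK0 (by nlinarith)
  refine ⟨w, hw, ?_⟩
  have h₃ : Real.sqrt n ≤ 12 * K := by
    rw [Real.sqrt_le_left (by positivity), sq]
    exact_mod_cast h₂.le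
  have h₄ : (r (FreeMonoid.ofList w) : ℝ) + 2 * K ≤ r (FreeMonoid.ofList (rhoList p w)) := by
    exact_mod_cast hr
  linarith

/-! ### From lists to the free monoid -/

section FreeMonoid

variable {Γ : Type*}

@[simp] lemma morphism_a (u v : FreeMonoid Γ) : morphism u v a = u := by
  simp [morphism, a]

@[simp] lemma morphism_b (u v : FreeMonoid Γ) : morphism u v b = v := by
  simp [morphism, b]

lemma morphism_ofList (u v : FreeMonoid Γ) (l : List Binary) :
    morphism u v (FreeMonoid.ofList l) =
      FreeMonoid.ofList (l.flatMap ![u.toList, v.toList]) := by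
  induction l with
  | nil => exact map_one _
  | cons i l ih =>
    rw [FreeMonoid.ofList_cons, map_mul, ih, List.flatMap_cons, FreeMonoid.ofList_append]
    congr 1

lemma hom_ext_binary {M : Type*} [Monoid M] {f g : FreeMonoid Binary →* M} (ha : f a = g a)
    (hb : f b = g b) : f = g := by
  refine FreeMonoid.hom_eq fun i => ?_
  fin_cases i
  · exact ha
  · exact hb

lemma rho_ofList (p : ℕ) (l : List Binary) :
    rho p (FreeMonoid.ofList l) = FreeMonoid.ofList (rhoList p l) := by
  have hpow : ∀ p : ℕ, (b ^ p).toList = List.replicate p 1 := by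
    intro p
    induction p with
    | zero => rfl
    | succ p ih => rw [pow_succ, FreeMonoid.toList_mul, ih, List.replicate_succ']; rfl
  rw [rho, morphism_ofList, hpow, rhoList]
  rfl

lemma a_mul_b_ne : a * b ≠ b * a := by
  intro h
  have := congrArg FreeMonoid.toList h
  revert this
  decide

/-- A binary morphism whose images do not commute does not decrease the number of runs. -/
theorem r_le_r_morphism [LinearOrder Γ] {u v : FreeMonoid Γ} (h : u * v ≠ v * u)
    (w : FreeMonoid Binary) : r w ≤ r (morphism u v w) := by
  have := r_le_r_flatMap (f := ![u.toList, v.toList])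
    (fun h' => h (FreeMonoid.toList.injective h')) w.toList
  rwa [← morphism_ofList, FreeMonoid.ofList_toList] at this

lemma E_E (w : FreeMonoid Binary) : E (E w) = w := by
  have h : E.comp E = MonoidHom.id _ := hom_ext_binary (by simp [E]) (by simp [E])
  exact DFunLike.congr_fun h w

lemma length_E (w : FreeMonoid Binary) : (E w).length = w.length := by
  induction w using FreeMonoid.recOn with
  | one => simp
  | of_mul i w ih =>
    rw [map_mul, FreeMonoid.length_mul, FreeMonoid.length_mul, ih]
    fin_cases i <;> simp [E, morphism, a, b]

/-- Exchanging the letters does not increase the number of runs. -/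
lemma r_E_le (w : FreeMonoid Binary) : r (E w) ≤ r w := by
  have := r_le_r_morphism a_mul_b_ne.symm (E w)
  rwa [← E, E_E] at this

lemma deltaAdd_le_AS [LinearOrder Γ] (μ : FreeMonoid Binary →* FreeMonoid Γ)
    (w : FreeMonoid Binary) : deltaAdd μ w ≤ AS μ w.length := by
  have h := Finset.le_sup' (fun w : Fin w.length → Binary =>
    deltaAdd μ (FreeMonoid.ofList (List.ofFn w))) (Finset.mem_univ fun i => w.toList.get i)
  have h' : FreeMonoid.ofList (List.ofFn fun i => w.toList.get i) = w := by
    rw [List.ofFn_get, FreeMonoid.ofList_toList]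
  exact (congrArg (deltaAdd μ) h').symm.le.trans h

/-- The lower bound for `rho p` passes to every morphism that creates at least as many runs, up to
a length-preserving change of the word. -/
lemma eventually_le_AS [LinearOrder Γ] {p : ℕ} (hp : 1 < p)
    (μ : FreeMonoid Binary →* FreeMonoid Γ) (φ : FreeMonoid Binary → FreeMonoid Binary)
    (hlen : ∀ w, (φ w).length = w.length) (hr : ∀ w, r (φ w) ≤ r w)
    (hμ : ∀ w, r (rho p w) ≤ r (μ (φ w))) :
    ∃ c : ℝ, 0 < c ∧ ∀ᶠ n : ℕ in Filter.atTop, c * Real.sqrt (n : ℝ) ≤ (AS μ n : ℝ) := by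
  obtain ⟨c, hc, h⟩ := eventually_exists_r_rhoList_ge hp
  refine ⟨c, hc, h.mono ?_⟩
  rintro n ⟨w, rfl, hw⟩
  rw [← rho_ofList] at hw
  have h₁ := deltaAdd_le_AS μ (φ (FreeMonoid.ofList w))
  rw [hlen, deltaAdd] at h₁
  have h₂ : (r (μ (φ (FreeMonoid.ofList w))) : ℝ) - r (φ (FreeMonoid.ofList w))
      ≤ AS μ w.length := by exact_mod_cast h₁
  have h₃ : (r (φ (FreeMonoid.ofList w)) : ℝ) ≤ r (FreeMonoid.ofList w) := by
    exact_mod_cast hr _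
  have h₄ : (r (rho p (FreeMonoid.ofList w)) : ℝ) ≤ r (μ (φ (FreeMonoid.ofList w))) := by
    exact_mod_cast hμ _
  linarith

lemma exists_isPrimitive_pow {w : FreeMonoid Γ} (hw : w ≠ 1) :
    ∃ (u : FreeMonoid Γ) (p : ℕ), IsPrimitive u ∧ 1 ≤ p ∧ w = u ^ p := by
  induction hn : w.length using Nat.strong_induction_on generalizing w with
  | _ n ih =>
    by_cases h : IsPrimitive w
    · exact ⟨w, 1, h, le_rfl, (pow_one w).symm⟩
    · unfold IsPrimitive at h
      push Not at h
      obtain ⟨u, hu, k, rfl, hk⟩ := h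
      have hk0 : k ≠ 0 := by
        rintro rfl
        exact hw (pow_zero u)
      have hulen : 0 < u.length := Nat.pos_of_ne_zero fun h => hu (FreeMonoid.length_eq_zero.1 h)
      have hpow : ∀ k : ℕ, (u ^ k).length = k * u.length := by
        intro k
        induction k with
        | zero => simp
        | succ k ih => rw [pow_succ, FreeMonoid.length_mul, ih, Nat.succ_mul]
      obtain ⟨z, j, hz, hj, rfl⟩ := ih u.length (by
        rw [← hn, hpow]
        have : 2 ≤ k := by omega
        nlinarith) hu rfl
      exact ⟨z, j * k, hz, Nat.mul_pos hj (Nat.pos_of_ne_zero hk0), (pow_mul z j k).symm⟩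

end FreeMonoid

end BWTRuns

theorem mainTheorem6 :
    (∀ p : ℕ, 1 < p →
      ∃ c : ℝ, 0 < c ∧ ∀ᶠ n : ℕ in Filter.atTop,
        c * Real.sqrt (n : ℝ) ≤ (BWTRuns.AS (BWTRuns.rho p) n : ℝ)) ∧
    (∀ (Γ : Type*) [LinearOrder Γ] (μ : FreeMonoid BWTRuns.Binary →* FreeMonoid Γ),
      Function.Injective μ →
      (∃ (u v : FreeMonoid Γ) (p q : ℕ),
        BWTRuns.IsPrimitive u ∧ BWTRuns.IsPrimitive v ∧ 1 ≤ p ∧ 1 ≤ q ∧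
          μ = BWTRuns.morphism (u ^ p) (v ^ q)) ∧
      ∀ (u v : FreeMonoid Γ) (p q : ℕ),
        BWTRuns.IsPrimitive u → BWTRuns.IsPrimitive v → 1 ≤ p → 1 ≤ q →
        μ = BWTRuns.morphism (u ^ p) (v ^ q) →
          μ = (BWTRuns.morphism u v).comp ((BWTRuns.rho q).comp
                (BWTRuns.E.comp ((BWTRuns.rho p).comp BWTRuns.E))) ∧
          (1 < p * q →
            ∃ c : ℝ, 0 < c ∧ ∀ᶠ n : ℕ in Filter.atTop,
              c * Real.sqrt (n : ℝ) ≤ (BWTRuns.AS μ n : ℝ))) := by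
  open BWTRuns in
  refine ⟨fun p hp => eventually_le_AS hp _ id (fun _ => rfl) (fun _ => le_rfl) fun _ => le_rfl,
    fun Γ _ μ hμ => ⟨?_, ?_⟩⟩
  · have hne : ∀ i, μ (FreeMonoid.of i) ≠ 1 := fun i h =>
      FreeMonoid.of_ne_one i (hμ (h.trans (map_one μ).symm))
    obtain ⟨u, p, hu, hp, hup⟩ := exists_isPrimitive_pow (hne 0)
    obtain ⟨v, q, hv, hq, hvq⟩ := exists_isPrimitive_pow (hne 1)
    exact ⟨u, v, p, q, hu, hv, hp, hq, hom_ext_binary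
      (hup.trans (morphism_a _ _).symm) (hvq.trans (morphism_b _ _).symm)⟩
  · rintro u v p q - - hp hq rfl
    refine ⟨hom_ext_binary (by simp [E, rho]) (by simp [E, rho]), fun hpq => ?_⟩
    have hcomm : ¬ Commute (u ^ p) (v ^ q) := by
      intro h
      refine a_mul_b_ne (hμ ?_)
      rw [map_mul, map_mul, morphism_a, morphism_b]
      exact h
    rcases hq.lt_or_eq with hq' | rfl
    · -- `μ` factors through `rho q`.
      have hfac : morphism (u ^ p) (v ^ q) = (morphism (u ^ p) v).comp (rho q) :=
        hom_ext_binary (by simp [rho]) (by simp [rho])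
      refine eventually_le_AS hq' _ id (fun _ => rfl) (fun _ => le_rfl) fun w => ?_
      rw [hfac]
      exact r_le_r_morphism (fun h => hcomm (Commute.pow_right h q)) _
    · -- `μ` factors through `rho p`, up to an exchange of the letters.
      have hfac : (morphism (u ^ p) (v ^ 1)).comp E = (morphism v u).comp (rho p) :=
        hom_ext_binary (by simp [E, rho]) (by simp [E, rho])
      refine eventually_le_AS (p := p) (by omega) _ E length_E r_E_le fun w => ?_
      have hw := DFunLike.congr_fun hfac w
      rw [MonoidHom.comp_apply, MonoidHom.comp_apply] at hw
      rw [hw]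
      exact r_le_r_morphism (fun h => hcomm
        (Commute.pow_pow (show Commute v u from h).symm p 1)) _
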